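/- Let $\mathcal S(\mathbb R)$ be the space of complex-valued Schwartz functions on $\mathbb R$. For $\varphi\in\mathcal S(\mathbb R)$ write $\widehat\varphi(\xi)=\int_{\mathbb R}e^{-ix\xi}\varphi(x)\,dx$, and for $\Phi:\mathbb R\to\mathbb R$ continuous and $t\in\mathbb R$ let $e^{it\Phi(D)}\varphi$ be the function whose Fourier transform is $e^{it\Phi(\xi)}\widehat\varphi(\xi)$, that is, $$\bigl(e^{it\Phi(D)}\varphi\bigr)(x)=\frac1{2\pi}\int_{\mathbb R}e^{ix\xi}\,e^{it\Phi(\xi)}\,\widehat\varphi(\xi)\,d\xi .$$ Let $\|\varphi\|_{H^1}=\bigl(\|\varphi\|_{L^2}^2+\|\partial_x\varphi\|_{L^2}^2\bigr)^{1/2}$. **Proposition.** Fix $\frac13<\alpha<\frac12$ and let $\Phi_\alpha(\xi)=|\xi|^\alpha$ for $\xi\in\mathbb R$. Then there exists a constant $C=C(\alpha)>0$ such that $$\|e^{it\Phi_\alpha(D)}\varphi\|_{L^\infty(\mathbb R)}\le C\,(1+|t|)^{-1/2}\bigl(\|\varphi\|_{H^1(\mathbb R)}+\|x\,\partial_x\varphi\|_{L^2(\mathbb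 R)}\bigr)$$ for every $t\in\mathbb R$ and every $\varphi\in\mathcal S(\mathbb R)$. -/

import Mathlib

open MeasureTheory SchwartzMap
open scoped ENNReal

/-- The Fourier transform in the angular-frequency convention,
`φ̂(ξ) = ∫ e^{-i x ξ} φ(x) dx`, for which `D = -i d/dx` has symbol `ξ` and
`-Δ = -d²/dx²` has symbol `ξ²`. -/
noncomputable def fourierHat (φ : 𝓢(ℝ, ℂ)) (ξ : ℝ) : ℂ :=
  ∫ x : ℝ, Complex.exp (-(Complex.I * (x * ξ : ℝ))) * φ x

/-- The function `e^{itΦ(D)} φ`, whose Fourier transform is `e^{itΦ(ξ)} φ̂(ξ)`: the inverse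
Fourier transform `(2π)⁻¹ ∫ e^{i x ξ} e^{itΦ(ξ)} φ̂(ξ) dξ`. -/
noncomputable def expMultiplier (Φ : ℝ → ℝ) (t : ℝ) (φ : 𝓢(ℝ, ℂ)) (x : ℝ) : ℂ :=
  ((2 * Real.pi)⁻¹ : ℝ) * ∫ ξ : ℝ,
    Complex.exp (Complex.I * (x * ξ : ℝ)) *
      (Complex.exp (Complex.I * (t * Φ ξ : ℝ)) * fourierHat φ ξ)

/-- The symbol `Φ_α(ξ) = |ξ|^α`. -/
noncomputable def powerSymbol (α : ℝ) (ξ : ℝ) : ℝ := |ξ| ^ α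

/-- The `L²(ℝ)` norm, as a real number. -/
noncomputable def l2Norm (f : ℝ → ℂ) : ℝ := (eLpNorm f 2 volume).toReal

/-- The `H¹(ℝ)` norm `(‖φ‖²_{L²} + ‖φ'‖²_{L²})^{1/2}`. -/
noncomputable def h1Norm (φ : 𝓢(ℝ, ℂ)) : ℝ :=
  Real.sqrt (l2Norm φ ^ 2 + l2Norm (deriv φ) ^ 2)

open Set Filter Topology FourierTransform

/-! By Plancherel, the right-hand norm controls `G`, `s G` and `s G'` in L², where `G` is the
Fourier transform of `φ`; the identity `w (𝓕 f)' = -𝓕 (x f') - 𝓕 f` handles the last one. The claim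
thus becomes a bound of order `N T^(-1/2)`, uniform in `X`, for the oscillatory integral of `G` with
phase `X s ± T |s|^α`. Reflection and conjugation reduce it to the half-line and the convex phase `X
s - T s^α`.

On `[a, 2a]` the second derivative of the phase is of size `T a^(α-2)`, so the stationary region has
width `δ ~ T^(-1/2) a^(1-α/2)`. Van der Corput's method (`norm_integral_exp_mul_le_of_le_deriv2`)
gives a bound of order `M δ + D δ^(3/2)`, with `M = sup |g|` and `D = N / a` bounding the L² norm of
`g'`. The weighted norms give `|g(s)| ≤ 2N min(s^(-1/2), s^(-1))`.

The factor left beside `N T^(-1/2)` is at most `a^σ` for `a ≤ 1` and `a^(-σ)` for `1 ≤ a ≤ T`, up to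
a constant, with `σ = (3α-1)/4`. The derivative term decides both: `α < 1/2` gives `a^(1/2-3α/4) ≤
a^σ` for small `a`, while `T^(-1/4) ≤ a^(-1/4)` gives `a^(-σ)` for large `a`. Since `α > 1/3`, the
dyadic sums converge geometrically. Near zero and beyond about `T`, Cauchy–Schwarz suffices
(`norm_integral_Ioi_phase_le`). -/

lemma integral_mul_le_of_sq_le {X : Type*} [MeasurableSpace X] {μ : Measure X} {f g : X → ℝ}
    {A B : ℝ} (hf : AEStronglyMeasurable f μ) (hg : AEStronglyMeasurable g μ)
    (hf0 : ∀ s, 0 ≤ f s) (hg0 : ∀ s, 0 ≤ g s)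
    (hf2 : Integrable (fun s => f s ^ 2) μ) (hg2 : Integrable (fun s => g s ^ 2) μ)
    (hA : 0 ≤ A) (hB : 0 ≤ B) (hfA : ∫ s, f s ^ 2 ∂μ ≤ A ^ 2) (hgB : ∫ s, g s ^ 2 ∂μ ≤ B ^ 2) :
    Integrable (fun s => f s * g s) μ ∧ ∫ s, f s * g s ∂μ ≤ A * B := by
  have hfL : MemLp f 2 μ := (memLp_two_iff_integrable_sq hf).2 hf2
  have hgL : MemLp g 2 μ := (memLp_two_iff_integrable_sq hg).2 hg2
  refine ⟨hfL.integrable_mul hgL, ?_⟩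
  have h := integral_mul_le_Lp_mul_Lq_of_nonneg (μ := μ) Real.HolderConjugate.two_two
    (ae_of_all _ hf0) (ae_of_all _ hg0) (by simpa using hfL) (by simpa using hgL)
  refine h.trans ?_
  simp only [Real.rpow_two, ← Real.sqrt_eq_rpow]
  gcongr
  · exact Real.sqrt_le_iff.2 ⟨hA, hfA⟩
  · exact Real.sqrt_le_iff.2 ⟨hB, hgB⟩

lemma hasDerivAt_neg_inv_comp {f : ℝ → ℝ} {d s : ℝ} (h : HasDerivAt f d s) (h0 : f s ≠ 0) :
    HasDerivAt (fun s => -(f s)⁻¹) (d / f s ^ 2) s :=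
  (h.inv h0).neg.congr_deriv (by rw [neg_div, neg_neg])

/-! ### Van der Corput estimates with an L² bound on the derivative of the amplitude -/

section Oscillatory

variable {a b δ M D : ℝ} {ψ ψ' ψ'' : ℝ → ℝ} {g g' : ℝ → ℂ}

lemma integral_inv_sq_sub_le (hδ : 0 < δ) (hab : a + δ ≤ b) :
    ∫ s in (a + δ)..b, ((s - a)⁻¹) ^ 2 ≤ δ⁻¹ := by
  have h : ∫ s in (a + δ)..b, ((s - a)⁻¹) ^ 2 = (-(b - a)⁻¹) - (-(a + δ - a)⁻¹) := by
    apply intervalIntegral.integral_eq_sub_of_hasDerivAt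
      (f := fun s => -(s - a)⁻¹)
    · intro s hs
      rw [uIcc_of_le hab] at hs
      have h0 : s - a ≠ 0 := by linarith [hs.1]
      exact (hasDerivAt_neg_inv_comp ((hasDerivAt_id' s).sub_const a) h0).congr_deriv (by simp)
    · apply ContinuousOn.intervalIntegrable
      rw [uIcc_of_le hab]
      intro s hs
      have h0 : s - a ≠ 0 := by linarith [hs.1]
      exact ((continuousAt_id.sub continuousAt_const).inv₀ h0 |>.pow 2).continuousWithinAt
  rw [h]
  have : 0 ≤ (b - a)⁻¹ := inv_nonneg.2 (by linarith)
  simp only [add_sub_cancel_left]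
  linarith

/-- Integrate by parts against `exp(iψ)`, using `1/ψ' ≤ δ² / (s - a)`, which is at most `δ` here.
The two boundary terms and the term with `ψ''/ψ'^2` cost `M δ` each; Cauchy–Schwarz on the term with
`g'/ψ'` costs `D δ^(3/2)`. -/
lemma norm_integral_exp_mul_le_of_nonstationary (hδ : 0 < δ) (hab : a + δ ≤ b)
    (hψ : ∀ s ∈ Icc (a + δ) b, HasDerivAt ψ (ψ' s) s)
    (hψ' : ∀ s ∈ Icc (a + δ) b, HasDerivAt ψ' (ψ'' s) s)
    (hψc : ContinuousOn ψ'' (Icc (a + δ) b))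
    (hpos : ∀ s ∈ Icc (a + δ) b, 0 ≤ ψ'' s)
    (hlow : ∀ s ∈ Icc (a + δ) b, (s - a) / δ ^ 2 ≤ ψ' s)
    (hg : ∀ s ∈ Icc (a + δ) b, HasDerivAt g (g' s) s) (hgc : ContinuousOn g' (Icc (a + δ) b))
    (hM : ∀ s ∈ Icc (a + δ) b, ‖g s‖ ≤ M) (hD0 : 0 ≤ D)
    (hD : ∫ s in (a + δ)..b, ‖g' s‖ ^ 2 ≤ D ^ 2) :
    ‖∫ s in (a + δ)..b, Complex.exp (Complex.I * ψ s) * g s‖ ≤ 3 * M * δ + D * δ * √δ := by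
  set p := a + δ with hp
  have hpmem : p ∈ Icc p b := ⟨le_rfl, hab⟩
  have hbmem : b ∈ Icc p b := ⟨hab, le_rfl⟩
  have hM0 : 0 ≤ M := (norm_nonneg _).trans (hM p hpmem)
  have hsa : ∀ s ∈ Icc p b, 0 < s - a := fun s hs => by have := hs.1; linarith
  have hψpos : ∀ s ∈ Icc p b, 0 < ψ' s := fun s hs =>
    (div_pos (hsa s hs) (by positivity)).trans_le (hlow s hs)
  have hlow1 : ∀ s ∈ Icc p b, (ψ' s)⁻¹ ≤ δ := fun s hs => by
    have h1 : δ⁻¹ ≤ ψ' s := by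
      refine le_trans ?_ (hlow s hs)
      rw [le_div_iff₀ (by positivity)]
      have : δ⁻¹ * δ ^ 2 = δ := by field_simp
      have := hs.1
      linarith
    exact inv_le_of_inv_le₀ hδ h1
  have hψ'c : ContinuousOn ψ' (Icc p b) := HasDerivAt.continuousOn hψ'
  have hψ0c : ContinuousOn ψ (Icc p b) := HasDerivAt.continuousOn hψ
  have hgc0 : ContinuousOn g (Icc p b) := HasDerivAt.continuousOn hg
  have hψne : ∀ s ∈ Icc p b, (ψ' s : ℂ) ≠ 0 := fun s hs => by
    exact_mod_cast (hψpos s hs).ne'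
  have hψ'C : ContinuousOn (fun s => (ψ' s : ℂ)) (Icc p b) :=
    Complex.continuous_ofReal.comp_continuousOn hψ'c
  have hψ''C : ContinuousOn (fun s => (ψ'' s : ℂ)) (Icc p b) :=
    Complex.continuous_ofReal.comp_continuousOn hψc
  have hψC : ContinuousOn (fun s => (ψ s : ℂ)) (Icc p b) :=
    Complex.continuous_ofReal.comp_continuousOn hψ0c
  set u : ℝ → ℂ := fun s => g s / (Complex.I * ψ' s) with hu
  set v : ℝ → ℂ := fun s => Complex.exp (Complex.I * ψ s) with hv
  set u' : ℝ → ℂ := fun s =>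
    (g' s * (Complex.I * ψ' s) - g s * (Complex.I * ψ'' s)) / (Complex.I * ψ' s) ^ 2 with hu'
  set v' : ℝ → ℂ := fun s => Complex.exp (Complex.I * ψ s) * (Complex.I * ψ' s) with hv'
  have hIne : ∀ s ∈ Icc p b, Complex.I * (ψ' s : ℂ) ≠ 0 := fun s hs =>
    mul_ne_zero Complex.I_ne_zero (hψne s hs)
  have huD : ∀ s ∈ uIcc p b, HasDerivAt u (u' s) s := by
    rw [uIcc_of_le hab]; intro s hs
    exact (hg s hs).div ((hψ' s hs).ofReal_comp.const_mul Complex.I) (hIne s hs)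
  have hvD : ∀ s ∈ uIcc p b, HasDerivAt v (v' s) s := by
    rw [uIcc_of_le hab]; intro s hs
    exact ((hψ s hs).ofReal_comp.const_mul Complex.I).cexp
  have hu'c : ContinuousOn u' (Icc p b) := by
    refine ContinuousOn.div ?_ ?_ (fun s hs => pow_ne_zero 2 (hIne s hs)) <;> fun_prop
  have hv'c : ContinuousOn v' (Icc p b) := by fun_prop
  have hibp := intervalIntegral.integral_mul_deriv_eq_deriv_mul huD hvD
    (ContinuousOn.intervalIntegrable (by rwa [uIcc_of_le hab]))
    (ContinuousOn.intervalIntegrable (by rwa [uIcc_of_le hab]))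
  have heq : ∫ s in p..b, Complex.exp (Complex.I * ψ s) * g s = ∫ s in p..b, u s * v' s := by
    apply intervalIntegral.integral_congr
    rw [uIcc_of_le hab]; intro s hs
    simp only [hu, hv']
    have := hIne s hs
    field_simp [this, hψne s hs]
  rw [heq, hibp]
  have hun : ∀ s ∈ Icc p b, ‖u s * v s‖ ≤ M * δ := fun s hs => by
    simp only [hu, hv, norm_mul, norm_div, Complex.norm_exp_I_mul_ofReal, Complex.norm_I, one_mul, mul_one,
      Complex.norm_real, Real.norm_of_nonneg (hψpos s hs).le]
    rw [div_eq_mul_inv]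
    exact mul_le_mul (hM s hs) (hlow1 s hs) (inv_nonneg.2 (hψpos s hs).le) hM0
  have hu'n : ∀ s ∈ Icc p b,
      ‖u' s * v s‖ ≤ ‖g' s‖ * (δ ^ 2 * (s - a)⁻¹) + M * (ψ'' s / ψ' s ^ 2) := fun s hs => by
    have h0 := hψpos s hs
    have e : u' s = g' s / (Complex.I * ψ' s) - g s * (Complex.I * ψ'' s) / (Complex.I * ψ' s) ^ 2 := by
      simp only [hu']
      have := hψne s hs
      field_simp
    simp only [hv, norm_mul, Complex.norm_exp_I_mul_ofReal, mul_one]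
    rw [e]
    refine (norm_sub_le _ _).trans (add_le_add ?_ ?_)
    · simp only [norm_mul, norm_div, Complex.norm_I, one_mul, Complex.norm_real,
        Real.norm_of_nonneg h0.le]
      rw [div_eq_mul_inv]
      refine mul_le_mul_of_nonneg_left ?_ (norm_nonneg _)
      rw [inv_le_comm₀ h0 (mul_pos (by positivity) (inv_pos.2 (hsa s hs)))]
      refine le_trans (le_of_eq ?_) (hlow s hs)
      have := hsa s hs
      field_simp
    · simp only [norm_mul, norm_div, norm_pow, Complex.norm_I, one_mul, Complex.norm_real,
        Real.norm_of_nonneg h0.le, Real.norm_of_nonneg (hpos s hs)]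
      rw [mul_div_assoc]
      exact mul_le_mul_of_nonneg_right (hM s hs) (div_nonneg (hpos s hs) (by positivity))
  have hsac : ContinuousOn (fun s : ℝ => (s - a)⁻¹) (Icc p b) :=
    ContinuousOn.inv₀ (by fun_prop) fun s hs => (hsa s hs).ne'
  have hint1 : IntervalIntegrable (fun s => ‖g' s‖ * (δ ^ 2 * (s - a)⁻¹)) volume p b :=
    ContinuousOn.intervalIntegrable (by rw [uIcc_of_le hab]; fun_prop)
  have hint2c : ContinuousOn (fun s => ψ'' s / ψ' s ^ 2) (Icc p b) :=
    hψc.div (hψ'c.pow 2) fun s hs => pow_ne_zero 2 (hψpos s hs).ne'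
  have hint2 : IntervalIntegrable (fun s => M * (ψ'' s / ψ' s ^ 2)) volume p b :=
    ContinuousOn.intervalIntegrable (by rw [uIcc_of_le hab]; fun_prop)
  have h3 : ‖∫ s in p..b, u' s * v s‖ ≤
      ∫ s in p..b, (‖g' s‖ * (δ ^ 2 * (s - a)⁻¹) + M * (ψ'' s / ψ' s ^ 2)) := by
    apply intervalIntegral.norm_integral_le_of_norm_le hab _ (hint1.add hint2)
    exact ae_of_all _ fun s hs => hu'n s ⟨hs.1.le, hs.2⟩
  rw [intervalIntegral.integral_add hint1 hint2, intervalIntegral.integral_const_mul] at h3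
  -- The integrand is the exact derivative of `-1/ψ'`, so no upper bound on `ψ''` is needed.
  have h4 : ∫ s in p..b, ψ'' s / ψ' s ^ 2 ≤ δ := by
    have : ∫ s in p..b, ψ'' s / ψ' s ^ 2 = -(ψ' b)⁻¹ - -(ψ' p)⁻¹ := by
      apply intervalIntegral.integral_eq_sub_of_hasDerivAt (f := fun s => -(ψ' s)⁻¹)
      · rw [uIcc_of_le hab]; intro s hs
        exact hasDerivAt_neg_inv_comp (hψ' s hs) (hψpos s hs).ne'
      · exact ContinuousOn.intervalIntegrable (by rwa [uIcc_of_le hab])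
    rw [this]
    have h1 := hlow1 p hpmem
    have h2 : 0 ≤ (ψ' b)⁻¹ := inv_nonneg.2 (hψpos b hbmem).le
    linarith
  -- Cauchy–Schwarz. The absolute value in the second factor makes it nonnegative for every real
  -- `s`, also to the left of `a`.
  have h5 : ∫ s in p..b, ‖g' s‖ * (δ ^ 2 * (s - a)⁻¹) ≤ D * (δ * √δ) := by
    rw [intervalIntegral.integral_of_le hab]
    have hsub : Ioc p b ⊆ Icc p b := Ioc_subset_Icc_self
    refine (integral_mul_le_of_sq_le (μ := volume.restrict (Ioc p b))
      (g := fun s => |δ ^ 2 * (s - a)⁻¹|)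
      ((hgc.norm.mono hsub).aestronglyMeasurable measurableSet_Ioc)
      (ContinuousOn.aestronglyMeasurable (ContinuousOn.mono (by fun_prop) hsub) measurableSet_Ioc)
      (fun _ => norm_nonneg _) (fun _ => abs_nonneg _) ?_ ?_ hD0 (by positivity) ?_ ?_).2.trans' ?_
    · exact ((ContinuousOn.integrableOn_Icc (by fun_prop)).mono_set hsub)
    · exact ((ContinuousOn.integrableOn_Icc (by fun_prop)).mono_set hsub)
    · rwa [intervalIntegral.integral_of_le hab] at hD
    · simp only [sq_abs]
      rw [← intervalIntegral.integral_of_le hab]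
      simp only [mul_pow (δ ^ 2)]
      rw [intervalIntegral.integral_const_mul, mul_pow, Real.sq_sqrt hδ.le]
      calc (δ ^ 2) ^ 2 * ∫ s in p..b, (s - a)⁻¹ ^ 2 ≤ (δ ^ 2) ^ 2 * δ⁻¹ := by
            gcongr; exact integral_inv_sq_sub_le hδ hab
        _ = δ ^ 2 * δ := by field_simp
    · refine le_of_eq (setIntegral_congr_fun measurableSet_Ioc fun s hs => ?_)
      have := hsa s (hsub hs)
      rw [abs_of_nonneg (by positivity)]
  calc ‖u b * v b - u p * v p - ∫ s in p..b, u' s * v s‖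
      ≤ ‖u b * v b‖ + ‖u p * v p‖ + ‖∫ s in p..b, u' s * v s‖ :=
        (norm_sub_le _ _).trans (add_le_add (norm_sub_le _ _) le_rfl)
    _ ≤ M * δ + M * δ + (D * (δ * √δ) + M * δ) := by
        refine add_le_add (add_le_add (hun b hbmem) (hun p hpmem)) (h3.trans ?_)
        gcongr
    _ = 3 * M * δ + D * δ * √δ := by ring

lemma norm_integral_exp_mul_le_length (hab : a ≤ b) (hM : ∀ s ∈ Icc a b, ‖g s‖ ≤ M) :
    ‖∫ s in a..b, Complex.exp (Complex.I * ψ s) * g s‖ ≤ M * (b - a) := by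
  have := intervalIntegral.norm_integral_le_of_norm_le_const (a := a) (b := b) (C := M)
    (f := fun s => Complex.exp (Complex.I * ψ s) * g s) (fun s hs => by
      rw [uIoc_of_le hab] at hs
      rw [norm_mul, Complex.norm_exp_I_mul_ofReal, one_mul]
      exact hM s ⟨hs.1.le, hs.2⟩)
  rwa [abs_of_nonneg (by linarith)] at this

end Oscillatory

section Oscillatory

variable {a b δ M D : ℝ} {ψ ψ' ψ'' : ℝ → ℝ} {g g' : ℝ → ℂ}

lemma integral_norm_sq_le_of_subinterval {c d : ℝ} (hac : a ≤ c) (hcd : c ≤ d) (hdb : d ≤ b)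
    (hgc : ContinuousOn g' (Icc a b)) (hD : ∫ s in a..b, ‖g' s‖ ^ 2 ≤ D ^ 2) :
    ∫ s in c..d, ‖g' s‖ ^ 2 ≤ D ^ 2 := by
  refine (intervalIntegral.integral_mono_interval hac hcd hdb
    (ae_of_all _ fun s => by positivity) ?_).trans hD
  exact ContinuousOn.intervalIntegrable
    (by rw [uIcc_of_le (hac.trans (hcd.trans hdb))]; fun_prop)

/-- The piece of length `δ` next to `a` is bounded trivially by `M δ`. Beyond it the phase is no
longer stationary, because `ψ'` starts nonnegative and grows at rate at least `1/δ²`. -/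
lemma norm_integral_exp_mul_le_of_deriv_nonneg (hδ : 0 < δ) (hab : a ≤ b)
    (hψ : ∀ s ∈ Icc a b, HasDerivAt ψ (ψ' s) s)
    (hψ' : ∀ s ∈ Icc a b, HasDerivAt ψ' (ψ'' s) s)
    (hψc : ContinuousOn ψ'' (Icc a b)) (hlow : ∀ s ∈ Icc a b, 1 / δ ^ 2 ≤ ψ'' s)
    (h0 : 0 ≤ ψ' a)
    (hg : ∀ s ∈ Icc a b, HasDerivAt g (g' s) s) (hgc : ContinuousOn g' (Icc a b))
    (hM : ∀ s ∈ Icc a b, ‖g s‖ ≤ M) (hD0 : 0 ≤ D) (hD : ∫ s in a..b, ‖g' s‖ ^ 2 ≤ D ^ 2) :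
    ‖∫ s in a..b, Complex.exp (Complex.I * ψ s) * g s‖ ≤ 4 * M * δ + D * δ * √δ := by
  have hM0 : 0 ≤ M := (norm_nonneg _).trans (hM a ⟨le_rfl, hab⟩)
  by_cases hb : b ≤ a + δ
  · refine (norm_integral_exp_mul_le_length hab hM).trans ?_
    have h1 : M * (b - a) ≤ M * δ := mul_le_mul_of_nonneg_left (by linarith) hM0
    have h2 : 0 ≤ D * δ * √δ := by positivity
    have h3 : 0 ≤ M * δ := by positivity
    linarith
  push Not at hb
  have hsub : Icc (a + δ) b ⊆ Icc a b := Icc_subset_Icc_left (by linarith)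
  have hsub' : Icc a (a + δ) ⊆ Icc a b := Icc_subset_Icc_right hb.le
  have hψ'c : ContinuousOn ψ' (Icc a b) := HasDerivAt.continuousOn hψ'
  have hψ'low : ∀ s ∈ Icc a b, (s - a) / δ ^ 2 ≤ ψ' s := fun s hs => by
    have := (convex_Icc a b).mul_sub_le_image_sub_of_le_deriv (f := ψ') (C := 1 / δ ^ 2) hψ'c
      (fun x hx => (hψ' x (interior_subset hx)).differentiableAt.differentiableWithinAt)
      (fun x hx => by rw [(hψ' x (interior_subset hx)).deriv]; exact hlow x (interior_subset hx))
      a ⟨le_rfl, hab⟩ s hs hs.1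
    rw [one_div_mul_eq_div] at this
    linarith
  have hc : ContinuousOn (fun s => Complex.exp (Complex.I * ψ s) * g s) (Icc a b) := by
    have h1 : ContinuousOn g (Icc a b) := HasDerivAt.continuousOn hg
    have h2 : ContinuousOn (fun s => (ψ s : ℂ)) (Icc a b) :=
      Complex.continuous_ofReal.comp_continuousOn (HasDerivAt.continuousOn hψ)
    fun_prop
  rw [← intervalIntegral.integral_add_adjacent_intervals (b := a + δ)
    ((hc.mono hsub').intervalIntegrable_of_Icc (by linarith))
    ((hc.mono hsub).intervalIntegrable_of_Icc hb.le)]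
  refine (norm_add_le _ _).trans ?_
  have h1 := norm_integral_exp_mul_le_length (ψ := ψ) (by linarith : a ≤ a + δ)
    fun s hs => hM s (hsub' hs)
  have h2 := norm_integral_exp_mul_le_of_nonstationary hδ hb.le (fun s hs => hψ s (hsub hs))
    (fun s hs => hψ' s (hsub hs)) (hψc.mono hsub)
    (fun s hs => le_trans (by positivity) (hlow s (hsub hs))) (fun s hs => hψ'low s (hsub hs))
    (fun s hs => hg s (hsub hs)) (hgc.mono hsub) (fun s hs => hM s (hsub hs)) hD0
    (integral_norm_sq_le_of_subinterval (by linarith) hb.le le_rfl hgc hD)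
  rw [add_sub_cancel_left] at h1
  linarith

lemma norm_integral_exp_mul_le_of_deriv_nonpos (hδ : 0 < δ) (hab : a ≤ b)
    (hψ : ∀ s ∈ Icc a b, HasDerivAt ψ (ψ' s) s)
    (hψ' : ∀ s ∈ Icc a b, HasDerivAt ψ' (ψ'' s) s)
    (hψc : ContinuousOn ψ'' (Icc a b)) (hlow : ∀ s ∈ Icc a b, 1 / δ ^ 2 ≤ ψ'' s)
    (h0 : ψ' b ≤ 0)
    (hg : ∀ s ∈ Icc a b, HasDerivAt g (g' s) s) (hgc : ContinuousOn g' (Icc a b))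
    (hM : ∀ s ∈ Icc a b, ‖g s‖ ≤ M) (hD0 : 0 ≤ D) (hD : ∫ s in a..b, ‖g' s‖ ^ 2 ≤ D ^ 2) :
    ‖∫ s in a..b, Complex.exp (Complex.I * ψ s) * g s‖ ≤ 4 * M * δ + D * δ * √δ := by
  have hmem : ∀ s ∈ Icc (-b) (-a), -s ∈ Icc a b := fun s hs =>
    ⟨by linarith [hs.2], by linarith [hs.1]⟩
  have h := norm_integral_exp_mul_le_of_deriv_nonneg (a := -b) (b := -a) (M := M) (D := D)
    (ψ := fun s => ψ (-s)) (ψ' := fun s => -ψ' (-s)) (ψ'' := fun s => ψ'' (-s))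
    (g := fun s => g (-s)) (g' := fun s => -g' (-s)) hδ (by linarith)
    (fun s hs => ((hψ _ (hmem s hs)).scomp s (hasDerivAt_neg s)).congr_deriv (by simp))
    (fun s hs => (((hψ' _ (hmem s hs)).scomp s (hasDerivAt_neg s)).neg).congr_deriv (by simp))
    (hψc.comp continuous_neg.continuousOn hmem) (fun s hs => hlow _ (hmem s hs))
    (by simpa using h0)
    (fun s hs => ((hg _ (hmem s hs)).scomp s (hasDerivAt_neg s)).congr_deriv (by simp))
    (hgc.comp continuous_neg.continuousOn hmem).neg (fun s hs => hM _ (hmem s hs)) hD0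
    (by
      simp only [norm_neg]
      rw [intervalIntegral.integral_comp_neg (fun s => ‖g' s‖ ^ 2)]
      simpa using hD)
  rw [intervalIntegral.integral_comp_neg (fun s => Complex.exp (Complex.I * ψ s) * g s)] at h
  simpa using h

/-- A form of van der Corput's second derivative estimate, with the amplitude controlled by its
supremum and by the `L²` norm of its derivative. -/
lemma norm_integral_exp_mul_le_of_le_deriv2 (hδ : 0 < δ) (hab : a ≤ b)
    (hψ : ∀ s ∈ Icc a b, HasDerivAt ψ (ψ' s) s)
    (hψ' : ∀ s ∈ Icc a b, HasDerivAt ψ' (ψ'' s) s)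
    (hψc : ContinuousOn ψ'' (Icc a b)) (hlow : ∀ s ∈ Icc a b, 1 / δ ^ 2 ≤ ψ'' s)
    (hg : ∀ s ∈ Icc a b, HasDerivAt g (g' s) s) (hgc : ContinuousOn g' (Icc a b))
    (hM : ∀ s ∈ Icc a b, ‖g s‖ ≤ M) (hD0 : 0 ≤ D) (hD : ∫ s in a..b, ‖g' s‖ ^ 2 ≤ D ^ 2) :
    ‖∫ s in a..b, Complex.exp (Complex.I * ψ s) * g s‖ ≤ 8 * M * δ + 2 * D * δ * √δ := by
  have hM0 : 0 ≤ M := (norm_nonneg _).trans (hM a ⟨le_rfl, hab⟩)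
  have hX : 0 ≤ 4 * M * δ + D * δ * √δ := by positivity
  rcases le_total 0 (ψ' a) with ha | ha
  · have := norm_integral_exp_mul_le_of_deriv_nonneg hδ hab hψ hψ' hψc hlow ha hg hgc hM hD0 hD
    linarith
  rcases le_total (ψ' b) 0 with hb | hb
  · have := norm_integral_exp_mul_le_of_deriv_nonpos hδ hab hψ hψ' hψc hlow hb hg hgc hM hD0 hD
    linarith
  have hψ'c : ContinuousOn ψ' (Icc a b) := HasDerivAt.continuousOn hψ'
  -- Cutting at the stationary point leaves one piece for each sign of `ψ'`, whence the doubled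
  -- constants.
  obtain ⟨c, hc, hc0⟩ := intermediate_value_Icc hab hψ'c ⟨ha, hb⟩
  have hl : Icc a c ⊆ Icc a b := Icc_subset_Icc_right hc.2
  have hr : Icc c b ⊆ Icc a b := Icc_subset_Icc_left hc.1
  have hcont : ContinuousOn (fun s => Complex.exp (Complex.I * ψ s) * g s) (Icc a b) := by
    have h1 : ContinuousOn g (Icc a b) := HasDerivAt.continuousOn hg
    have h2 : ContinuousOn (fun s => (ψ s : ℂ)) (Icc a b) :=
      Complex.continuous_ofReal.comp_continuousOn (HasDerivAt.continuousOn hψ)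
    fun_prop
  have h1 := norm_integral_exp_mul_le_of_deriv_nonpos hδ hc.1 (fun s hs => hψ s (hl hs))
    (fun s hs => hψ' s (hl hs)) (hψc.mono hl) (fun s hs => hlow s (hl hs)) hc0.le
    (fun s hs => hg s (hl hs)) (hgc.mono hl) (fun s hs => hM s (hl hs)) hD0
    (integral_norm_sq_le_of_subinterval le_rfl hc.1 hc.2 hgc hD)
  have h2 := norm_integral_exp_mul_le_of_deriv_nonneg hδ hc.2 (fun s hs => hψ s (hr hs))
    (fun s hs => hψ' s (hr hs)) (hψc.mono hr) (fun s hs => hlow s (hr hs)) hc0.ge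
    (fun s hs => hg s (hr hs)) (hgc.mono hr) (fun s hs => hM s (hr hs)) hD0
    (integral_norm_sq_le_of_subinterval hc.1 hc.2 le_rfl hgc hD)
  rw [← intervalIntegral.integral_add_adjacent_intervals (b := c)
    ((hcont.mono hl).intervalIntegrable_of_Icc hc.1)
    ((hcont.mono hr).intervalIntegrable_of_Icc hc.2)]
  refine (norm_add_le _ _).trans ?_
  linarith

end Oscillatory

/-- `g` is continuously differentiable with derivative `g'`, it is integrable and vanishes at
infinity on the positive half-line, and `g`, `s g(s)` and `s g'(s)` have `L²(0, ∞)` norm at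
most `N`. -/
structure HalfLineBound (N : ℝ) (g g' : ℝ → ℂ) : Prop where
  hasDerivAt : ∀ s, HasDerivAt g (g' s) s
  continuous_deriv : Continuous g'
  tendsto : Tendsto g atTop (𝓝 0)
  integrableOn : IntegrableOn g (Ioi 0)
  nonneg : 0 ≤ N
  integrableOn_sq : IntegrableOn (fun s => ‖g s‖ ^ 2) (Ioi 0)
  integral_sq_le : ∫ s in Ioi 0, ‖g s‖ ^ 2 ≤ N ^ 2
  integrableOn_mul_sq : IntegrableOn (fun s => (|s| * ‖g s‖) ^ 2) (Ioi 0)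
  integral_mul_sq_le : ∫ s in Ioi 0, (|s| * ‖g s‖) ^ 2 ≤ N ^ 2
  integrableOn_mul_deriv_sq : IntegrableOn (fun s => (|s| * ‖g' s‖) ^ 2) (Ioi 0)
  integral_mul_deriv_sq_le : ∫ s in Ioi 0, (|s| * ‖g' s‖) ^ 2 ≤ N ^ 2

/-! ### Pointwise and integral bounds from the weighted L² norms -/

namespace HalfLineBound

variable {N : ℝ} {g g' : ℝ → ℂ}

lemma continuous (h : HalfLineBound N g g') : Continuous g :=
  continuous_iff_continuousAt.2 fun s => (h.hasDerivAt s).continuousAt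

lemma setIntegral_sq_le_of_subset {f : ℝ → ℝ} {S : Set ℝ} (hS : S ⊆ Ioi 0)
    (hi : IntegrableOn (fun s => f s ^ 2) (Ioi 0)) (hN : ∫ s in Ioi 0, f s ^ 2 ≤ N ^ 2) :
    ∫ s in S, f s ^ 2 ≤ N ^ 2 :=
  (setIntegral_mono_set hi (ae_of_all _ fun _ => sq_nonneg _)
    (LE.le.eventuallyLE hS)).trans hN

/-- As `g` vanishes at infinity, `|g(s)|²` is minus the integral of `2 Re(conj(g) g')` over `(s,
∞)`. There `1 ≤ |u|/s`, and Cauchy–Schwarz pairs `w` with `u g'`. The weights `|g|` (with `c = 1`)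
and `|u| |g|` (with `c = 1/s`) yield the decay rates `s^(-1/2)` and `s^(-1)`. -/
lemma norm_sq_le_of_weight (h : HalfLineBound N g g') {s c : ℝ} (hs : 0 < s) (hc : 0 ≤ c)
    {w : ℝ → ℝ} (hwc : Continuous w) (hw0 : ∀ u, 0 ≤ w u)
    (hwi : IntegrableOn (fun u => w u ^ 2) (Ioi 0)) (hwN : ∫ u in Ioi 0, w u ^ 2 ≤ N ^ 2)
    (hgw : ∀ u ∈ Ioi s, ‖g u‖ ≤ c * w u) : ‖g s‖ ^ 2 ≤ 2 * (c / s) * N ^ 2 := by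
  have hsub : Ioi s ⊆ Ioi 0 := Ioi_subset_Ioi hs.le
  have hg'c := h.continuous_deriv
  have hgc := h.continuous
  obtain ⟨hi, hle⟩ := integral_mul_le_of_sq_le (μ := volume.restrict (Ioi s)) (A := N) (B := N)
    (f := w) (g := fun u => |u| * ‖g' u‖) hwc.aestronglyMeasurable
    (by fun_prop) hw0 (fun u => by positivity)
    (hwi.mono_set hsub) (h.integrableOn_mul_deriv_sq.mono_set hsub) h.nonneg h.nonneg
    (setIntegral_sq_le_of_subset hsub hwi hwN)
    (setIntegral_sq_le_of_subset hsub h.integrableOn_mul_deriv_sq h.integral_mul_deriv_sq_le)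
  have hpt : ∀ u ∈ Ioi s, ‖2 * inner ℝ (g u) (g' u)‖ ≤ 2 * (c / s) * (w u * (|u| * ‖g' u‖)) := by
    intro u hu
    have hu' : s ≤ |u| := (le_of_lt hu).trans (le_abs_self u)
    rw [norm_mul, Real.norm_ofNat]
    have h1 : ‖inner ℝ (g u) (g' u)‖ ≤ ‖g u‖ * ‖g' u‖ := norm_inner_le_norm _ _
    have h2 : ‖g u‖ * ‖g' u‖ ≤ c * w u * (|u| / s * ‖g' u‖) := by
      refine mul_le_mul (hgw u hu) ?_ (norm_nonneg _) (mul_nonneg hc (hw0 u))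
      refine le_mul_of_one_le_left (norm_nonneg _) ?_
      rwa [le_div_iff₀ hs, one_mul]
    calc 2 * ‖inner ℝ (g u) (g' u)‖ ≤ 2 * (c * w u * (|u| / s * ‖g' u‖)) := by linarith
      _ = _ := by ring
  have hmajor := hi.const_mul (2 * (c / s))
  have hderiv : ∀ u ∈ Ici s, HasDerivAt (fun u => ‖g u‖ ^ 2) (2 * inner ℝ (g u) (g' u)) u :=
    fun u _ => (h.hasDerivAt u).norm_sq
  have hint : IntegrableOn (fun u => 2 * inner ℝ (g u) (g' u)) (Ioi s) :=
    hmajor.mono' (by fun_prop) ((ae_restrict_iff' measurableSet_Ioi).2 (ae_of_all _ hpt))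
  have htend : Tendsto (fun u => ‖g u‖ ^ 2) atTop (𝓝 0) := by
    simpa using (h.tendsto.norm.pow 2)
  have hftc := integral_Ioi_of_hasDerivAt_of_tendsto' hderiv hint htend
  have hnorm := norm_integral_le_of_norm_le hmajor
    ((ae_restrict_iff' measurableSet_Ioi).2 (ae_of_all _ hpt))
  rw [hftc, zero_sub, norm_neg, integral_const_mul, Real.norm_of_nonneg (by positivity)] at hnorm
  refine hnorm.trans ?_
  rw [sq N]
  exact mul_le_mul_of_nonneg_left hle (by positivity)

lemma norm_le_rpow_neg_half (h : HalfLineBound N g g') {s : ℝ} (hs : 0 < s) :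
    ‖g s‖ ≤ 2 * N * s ^ (-(1 / 2) : ℝ) := by
  have h1 := h.norm_sq_le_of_weight hs zero_le_one (w := fun u => ‖g u‖) h.continuous.norm
    (fun _ => norm_nonneg _) h.integrableOn_sq h.integral_sq_le (fun u _ => by simp)
  have hN := h.nonneg
  refine abs_le_of_sq_le_sq' ?_ (by positivity) |>.2
  have e : (s ^ (-(1 / 2) : ℝ)) ^ 2 = 1 / s := by
    rw [← Real.rpow_natCast, ← Real.rpow_mul hs.le]
    norm_num [Real.rpow_neg_one]
  rw [mul_pow, e, mul_pow]
  have : 0 ≤ 1 / s * N ^ 2 := by positivity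
  nlinarith

lemma norm_le_inv (h : HalfLineBound N g g') {s : ℝ} (hs : 0 < s) :
    ‖g s‖ ≤ 2 * N * s⁻¹ := by
  have hgc := h.continuous
  have h1 := h.norm_sq_le_of_weight hs (inv_nonneg.2 hs.le) (w := fun u => |u| * ‖g u‖)
    (by fun_prop) (fun _ => by positivity) h.integrableOn_mul_sq h.integral_mul_sq_le
    (fun u hu => by
      rw [← mul_assoc]
      refine le_mul_of_one_le_left (norm_nonneg _) ?_
      rw [inv_mul_eq_div, le_div_iff₀ hs, one_mul]
      exact (le_of_lt hu).trans (le_abs_self u))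
  have hN := h.nonneg
  refine abs_le_of_sq_le_sq' ?_ (by positivity) |>.2
  have e : s⁻¹ / s = s⁻¹ ^ 2 := by rw [div_eq_mul_inv, sq]
  rw [e] at h1
  rw [mul_pow, mul_pow]
  have : 0 ≤ s⁻¹ ^ 2 * N ^ 2 := by positivity
  nlinarith

lemma integral_norm_Ioc_le (h : HalfLineBound N g g') {R : ℝ} (hR : 0 ≤ R) :
    ∫ s in Ioc 0 R, ‖g s‖ ≤ N * √R := by
  have hsub : Ioc 0 R ⊆ Ioi 0 := Ioc_subset_Ioi_self
  have hgc := h.continuous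
  have := (integral_mul_le_of_sq_le (μ := volume.restrict (Ioc 0 R)) (A := N) (B := √R)
    (f := fun s => ‖g s‖) (g := fun _ => 1) (by fun_prop) (by fun_prop) (fun _ => norm_nonneg _)
    (fun _ => zero_le_one) (h.integrableOn_sq.mono_set hsub) (by simp) h.nonneg
    (Real.sqrt_nonneg _) (setIntegral_sq_le_of_subset hsub h.integrableOn_sq h.integral_sq_le)
    (by simp [Real.sq_sqrt hR, hR])).2
  simpa using this

lemma integral_norm_Ioi_le (h : HalfLineBound N g g') {R : ℝ} (hR : 0 < R) :
    ∫ s in Ioi R, ‖g s‖ ≤ N * (√R)⁻¹ := by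
  have hsub : Ioi R ⊆ Ioi 0 := Ioi_subset_Ioi hR.le
  have hgc := h.continuous
  have e : ∀ s ∈ Ioi R, (s⁻¹) ^ 2 = s ^ (-2 : ℝ) := fun s hs => by
    rw [Real.rpow_neg (hR.le.trans (le_of_lt hs)), inv_pow, Real.rpow_two]
  have := (integral_mul_le_of_sq_le (μ := volume.restrict (Ioi R)) (A := N) (B := (√R)⁻¹)
    (f := fun s => |s| * ‖g s‖) (g := fun s => |s⁻¹|) (by fun_prop)
    (by fun_prop) (fun _ => by positivity)
    (fun _ => by positivity) (h.integrableOn_mul_sq.mono_set hsub)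
    (by
      simp only [sq_abs]
      exact (integrableOn_congr_fun e measurableSet_Ioi).2
        (integrableOn_Ioi_rpow_of_lt (by norm_num) hR)) h.nonneg
    (by positivity) (setIntegral_sq_le_of_subset hsub h.integrableOn_mul_sq h.integral_mul_sq_le)
    (by
      simp only [sq_abs]
      rw [setIntegral_congr_fun measurableSet_Ioi e, integral_Ioi_rpow_of_lt (by norm_num) hR,
        inv_pow, Real.sq_sqrt hR.le]
      norm_num [Real.rpow_neg_one])).2
  refine (le_of_eq (setIntegral_congr_fun measurableSet_Ioi fun s hs => ?_)).trans this
  have : s ≠ 0 := (hR.trans hs).ne'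
  simp only [abs_inv]
  field_simp

lemma integral_norm_le (h : HalfLineBound N g g') : ∫ s in Ioi 0, ‖g s‖ ≤ 2 * N := by
  rw [← Ioc_union_Ioi_eq_Ioi (zero_le_one (α := ℝ)), setIntegral_union Ioc_disjoint_Ioi_same
    measurableSet_Ioi (h.integrableOn.mono_set Ioc_subset_Ioi_self).norm
    (h.integrableOn.mono_set (Ioi_subset_Ioi zero_le_one)).norm]
  have h1 := h.integral_norm_Ioc_le zero_le_one
  have h2 := h.integral_norm_Ioi_le zero_lt_one
  simp at h1 h2
  linarith

lemma integral_deriv_sq_le (h : HalfLineBound N g g') {a b : ℝ} (ha : 0 < a) (hab : a ≤ b) :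
    ∫ s in a..b, ‖g' s‖ ^ 2 ≤ (N / a) ^ 2 := by
  have hg'c := h.continuous_deriv
  have h1 : ∫ s in a..b, ‖g' s‖ ^ 2 ≤ ∫ s in a..b, (a ^ 2)⁻¹ * (|s| * ‖g' s‖) ^ 2 := by
    apply intervalIntegral.integral_mono_on hab
    · exact Continuous.intervalIntegrable (by fun_prop) _ _
    · exact Continuous.intervalIntegrable (by fun_prop) _ _
    · intro s hs
      rw [mul_pow, sq_abs, ← mul_assoc]
      refine le_mul_of_one_le_left (by positivity) ?_
      rw [inv_mul_eq_div, one_le_div (by positivity)]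
      exact pow_le_pow_left₀ ha.le hs.1 2
  refine h1.trans ?_
  rw [intervalIntegral.integral_const_mul, div_pow, div_eq_inv_mul]
  refine mul_le_mul_of_nonneg_left ?_ (by positivity)
  rw [intervalIntegral.integral_of_le hab]
  exact setIntegral_sq_le_of_subset (fun s hs => ha.trans hs.1)
    h.integrableOn_mul_deriv_sq h.integral_mul_deriv_sq_le

end HalfLineBound

/-! ### The oscillatory integral over one dyadic interval -/

section DyadicPiece

variable {α : ℝ}

/-- The constant `(α (1 - α) 2^(α - 2))^(-1/2)`, which fixes the width of the stationary region of
the phase `X s - T s^α` on a dyadic interval. -/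
noncomputable def stationaryConst (α : ℝ) : ℝ := (√(α * (1 - α) * 2 ^ (α - 2)))⁻¹

lemma stationaryConst_pos (h0 : 0 < α) (h1 : α < 1) : 0 < stationaryConst α := by
  have : 0 < 1 - α := by linarith
  unfold stationaryConst
  positivity

lemma inv_stationaryConst_sq (h0 : 0 < α) (h1 : α < 1) :
    1 / stationaryConst α ^ 2 = α * (1 - α) * 2 ^ (α - 2) := by
  have : 0 < 1 - α := by linarith
  unfold stationaryConst
  rw [inv_pow, Real.sq_sqrt (by positivity), one_div, inv_inv]

lemma rpow_neg_half_mul_rpow_sq {T a β : ℝ} (hT : 0 < T) (ha : 0 < a) :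
    (T ^ (-(1 / 2) : ℝ) * a ^ β) ^ 2 = T⁻¹ * a ^ (2 * β) := by
  rw [mul_pow, ← Real.rpow_natCast, ← Real.rpow_natCast, ← Real.rpow_mul hT.le,
    ← Real.rpow_mul ha.le, ← Real.rpow_neg_one]
  push_cast
  ring_nf

lemma norm_integral_dyadic_le {N T X a M : ℝ} {g g' : ℝ → ℂ} (h0 : 0 < α) (h1 : α < 1)
    (h : HalfLineBound N g g') (hT : 0 < T) (ha : 0 < a)
    (hM : ∀ s ∈ Icc a (2 * a), ‖g s‖ ≤ M) :
    ‖∫ s in a..(2 * a), Complex.exp (Complex.I * (X * s - T * s ^ α : ℝ)) * g s‖ ≤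
      8 * stationaryConst α * (M * (T ^ (-(1 / 2) : ℝ) * a ^ (1 - α / 2))) +
      2 * (stationaryConst α * √(stationaryConst α)) *
        (N * (T ^ (-(1 / 2) : ℝ) * (T ^ (-(1 / 4) : ℝ) * a ^ (1 / 2 - 3 * α / 4)))) := by
  set K := stationaryConst α with hK
  have hK0 : 0 < K := stationaryConst_pos h0 h1
  have hα1 : 0 < 1 - α := by linarith
  set δ := K * (T ^ (-(1 / 2) : ℝ) * a ^ (1 - α / 2)) with hδ
  have hδ0 : 0 < δ := by positivity
  -- The width `δ` is chosen so that `1/δ²` equals the second derivative of the phase at `2a`, its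
  -- minimum on `[a, 2a]`.
  have hsq : 1 / δ ^ 2 = T * (α * (1 - α)) * (2 * a) ^ (α - 2) := by
    rw [hδ, mul_pow, rpow_neg_half_mul_rpow_sq hT ha, ← one_div_mul_one_div,
      inv_stationaryConst_sq h0 h1, Real.mul_rpow zero_le_two ha.le]
    rw [show 2 * (1 - α / 2) = -(α - 2) by ring, Real.rpow_neg ha.le]
    field_simp
  have hpos : ∀ s ∈ Icc a (2 * a), 0 < s := fun s hs => ha.trans_le hs.1
  have hδδ : δ * √δ = a * (K * √K) *
      (T ^ (-(1 / 2) : ℝ) * (T ^ (-(1 / 4) : ℝ) * a ^ (1 / 2 - 3 * α / 4))) := by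
    rw [hδ, Real.sqrt_mul hK0.le, Real.sqrt_mul (by positivity)]
    have e1 : √(T ^ (-(1 / 2) : ℝ)) = T ^ (-(1 / 4) : ℝ) := by
      rw [Real.sqrt_eq_rpow, ← Real.rpow_mul hT.le]; norm_num
    have e2 : a ^ (1 - α / 2) * √(a ^ (1 - α / 2)) = a * a ^ (1 / 2 - 3 * α / 4) := by
      rw [Real.sqrt_eq_rpow, ← Real.rpow_mul ha.le, ← Real.rpow_add ha, ← Real.rpow_one_add' ha.le]
      · congr 1; ring
      · linarith
    rw [e1]
    linear_combination (K * √K * T ^ (-(1 / 2) : ℝ) * T ^ (-(1 / 4) : ℝ)) * e2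
  have key := norm_integral_exp_mul_le_of_le_deriv2 (a := a) (b := 2 * a) (δ := δ) (M := M)
    (D := N / a) (ψ := fun s => X * s - T * s ^ α) (ψ' := fun s => X - T * (α * s ^ (α - 1)))
    (ψ'' := fun s => T * (α * (1 - α)) * s ^ (α - 2)) (g := g) (g' := g') hδ0 (by linarith)
    (fun s hs => by
      have := ((hasDerivAt_id' s).const_mul X).sub
        ((Real.hasDerivAt_rpow_const (p := α) (Or.inl (hpos s hs).ne')).const_mul T)
      exact this.congr_deriv (by ring))
    (fun s hs => by
      have := (((Real.hasDerivAt_rpow_const (p := α - 1)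
        (Or.inl (hpos s hs).ne')).const_mul α).const_mul T).const_sub X
      refine this.congr_deriv ?_
      rw [show α - 1 - 1 = α - 2 by ring]
      ring)
    (ContinuousOn.mul continuousOn_const
      (ContinuousOn.rpow_const continuousOn_id fun s hs => Or.inl (hpos s hs).ne'))
    (fun s hs => by
      rw [hsq]
      refine mul_le_mul_of_nonneg_left ?_ (by positivity)
      exact Real.rpow_le_rpow_of_nonpos (hpos s hs) hs.2 (by linarith))
    (fun s _ => h.hasDerivAt s) h.continuous_deriv.continuousOn hM
    (div_nonneg h.nonneg ha.le) (h.integral_deriv_sq_le ha (by linarith))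
  refine key.trans (le_of_eq ?_)
  have e3 : 2 * (N / a) * δ * √δ = 2 * (N / a) * (δ * √δ) := by ring
  rw [e3, hδδ, hδ]
  field_simp

/-- A constant in the estimate on a dyadic interval. -/
noncomputable def dyadicConst (α : ℝ) : ℝ :=
  16 * stationaryConst α + 2 * (stationaryConst α * √(stationaryConst α))

/-- Here `ρ` is a common majorant for the amplitude and derivative terms, later a power of `a` that
is summable over the scales. -/
lemma norm_integral_dyadic_le_of_le {N T X a M ρ : ℝ} {g g' : ℝ → ℂ} (h0 : 0 < α) (h1 : α < 1)
    (h : HalfLineBound N g g') (hT : 0 < T) (ha : 0 < a)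
    (hM : ∀ s ∈ Icc a (2 * a), ‖g s‖ ≤ M)
    (h2 : M * a ^ (1 - α / 2) ≤ 2 * N * ρ)
    (h3 : T ^ (-(1 / 4) : ℝ) * a ^ (1 / 2 - 3 * α / 4) ≤ ρ) :
    ‖∫ s in a..(2 * a), Complex.exp (Complex.I * (X * s - T * s ^ α : ℝ)) * g s‖ ≤
      dyadicConst α * N * T ^ (-(1 / 2) : ℝ) * ρ := by
  have hK := stationaryConst_pos h0 h1
  have hN := h.nonneg
  have hT' : 0 < T ^ (-(1 / 2) : ℝ) := by positivity
  refine (norm_integral_dyadic_le h0 h1 h hT ha hM).trans ?_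
  calc _ = 8 * stationaryConst α * T ^ (-(1 / 2) : ℝ) * (M * a ^ (1 - α / 2)) +
      2 * (stationaryConst α * √(stationaryConst α)) * N * T ^ (-(1 / 2) : ℝ) *
        (T ^ (-(1 / 4) : ℝ) * a ^ (1 / 2 - 3 * α / 4)) := by ring
    _ ≤ 8 * stationaryConst α * T ^ (-(1 / 2) : ℝ) * (2 * N * ρ) +
      2 * (stationaryConst α * √(stationaryConst α)) * N * T ^ (-(1 / 2) : ℝ) * ρ := by gcongr
    _ = _ := by unfold dyadicConst; ring

lemma norm_integral_dyadic_le_of_le_one {N T X a : ℝ} {g g' : ℝ → ℂ} (hα : 1 / 3 < α)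
    (hα' : α < 1 / 2) (h : HalfLineBound N g g') (hT : 1 ≤ T) (ha : 0 < a) (ha1 : a ≤ 1) :
    ‖∫ s in a..(2 * a), Complex.exp (Complex.I * (X * s - T * s ^ α : ℝ)) * g s‖ ≤
      dyadicConst α * N * T ^ (-(1 / 2) : ℝ) * a ^ ((3 * α - 1) / 4) := by
  have hN := h.nonneg
  refine norm_integral_dyadic_le_of_le (M := 2 * N * a ^ (-(1 / 2) : ℝ)) (by linarith) (by linarith)
    h (by linarith) ha (fun s hs => ?_) ?_ ?_
  · refine (h.norm_le_rpow_neg_half (ha.trans_le hs.1)).trans ?_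
    exact mul_le_mul_of_nonneg_left (Real.rpow_le_rpow_of_nonpos ha hs.1 (by norm_num))
      (by positivity)
  · rw [mul_assoc (2 * N), ← Real.rpow_add ha]
    exact mul_le_mul_of_nonneg_left (Real.rpow_le_rpow_of_exponent_ge ha ha1 (by linarith))
      (by positivity)
  -- The factor `T^(-1/4)` is discarded; the exponent comparison `(3α-1)/4 ≤ 1/2 - 3α/4` is exactly
  -- `α ≤ 1/2`.
  · refine (mul_le_of_le_one_left (by positivity)
      (Real.rpow_le_one_of_one_le_of_nonpos hT (by norm_num))).trans ?_
    exact Real.rpow_le_rpow_of_exponent_ge ha ha1 (by linarith)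

lemma norm_integral_dyadic_le_of_one_le {N T X a : ℝ} {g g' : ℝ → ℂ} (hα : 1 / 3 < α)
    (hα' : α < 1 / 2) (h : HalfLineBound N g g') (ha : 1 ≤ a) (haT : a ≤ T) :
    ‖∫ s in a..(2 * a), Complex.exp (Complex.I * (X * s - T * s ^ α : ℝ)) * g s‖ ≤
      dyadicConst α * N * T ^ (-(1 / 2) : ℝ) * a ^ (-((3 * α - 1) / 4)) := by
  have hN := h.nonneg
  have ha0 : 0 < a := by linarith
  refine norm_integral_dyadic_le_of_le (M := 2 * N * a⁻¹) (by linarith) (by linarith)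
    h (by linarith) ha0 (fun s hs => ?_) ?_ ?_
  · refine (h.norm_le_inv (ha0.trans_le hs.1)).trans ?_
    exact mul_le_mul_of_nonneg_left (inv_anti₀ ha0 hs.1) (by positivity)
  · rw [mul_assoc (2 * N), ← Real.rpow_neg_one, ← Real.rpow_add ha0]
    exact mul_le_mul_of_nonneg_left (Real.rpow_le_rpow_of_exponent_le ha (by linarith))
      (by positivity)
  -- This is where `a ≤ T` enters: trading `T^(-1/4)` for `a^(-1/4)` makes the total exponent `1/4 -
  -- 3α/4` negative.
  · have : T ^ (-(1 / 4) : ℝ) ≤ a ^ (-(1 / 4) : ℝ) :=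
      Real.rpow_le_rpow_of_nonpos ha0 haT (by norm_num)
    refine (mul_le_mul_of_nonneg_right this (by positivity)).trans (le_of_eq ?_)
    rw [← Real.rpow_add ha0]
    congr 1; ring

end DyadicPiece

/-! ### Summation over dyadic scales on the half-line -/

section HalfLine

variable {α : ℝ}

lemma two_pow_rpow_neg (σ : ℝ) (k : ℕ) : ((2 : ℝ) ^ k) ^ (-σ) = (2 ^ (-σ)) ^ k := by
  rw [← Real.rpow_natCast, ← Real.rpow_natCast, ← Real.rpow_mul zero_le_two,
    ← Real.rpow_mul zero_le_two, mul_comm]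

lemma sum_pow_le_inv_one_sub {r : ℝ} (h0 : 0 ≤ r) (h1 : r < 1) (m : ℕ) :
    ∑ k ∈ Finset.range m, r ^ k ≤ (1 - r)⁻¹ := by
  rw [← tsum_geometric_of_lt_one h0 h1]
  exact (summable_geometric_of_lt_one h0 h1).sum_le_tsum _ fun _ _ => by positivity

lemma exp_phase_continuous (hα : 0 < α) (X T : ℝ) :
    Continuous fun s : ℝ => Complex.exp (Complex.I * (X * s - T * s ^ α : ℝ)) := by
  have : Continuous fun s : ℝ => s ^ α := Real.continuous_rpow_const hα.le
  fun_prop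

lemma norm_integral_Ioi_phase_le {N T X : ℝ} {g g' : ℝ → ℂ} (hα : 1 / 3 < α)
    (hα' : α < 1 / 2) (h : HalfLineBound N g g') (hT : 1 ≤ T) :
    ‖∫ s in Ioi 0, Complex.exp (Complex.I * (X * s - T * s ^ α : ℝ)) * g s‖ ≤
      (2 + 2 * dyadicConst α * (1 - 2 ^ (-((3 * α - 1) / 4)))⁻¹) * (N * T ^ (-(1 / 2) : ℝ)) := by
  set σ := (3 * α - 1) / 4 with hσ
  set r : ℝ := 2 ^ (-σ) with hr
  have hT0 : 0 < T := by linarith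
  have hσ0 : 0 < σ := by rw [hσ]; linarith
  have hr0 : 0 ≤ r := by positivity
  have hr1 : r < 1 := Real.rpow_lt_one_of_one_lt_of_neg one_lt_two (by linarith)
  have hN := h.nonneg
  have hK := stationaryConst_pos (by linarith : 0 < α) (by linarith : α < 1)
  have hK' : 0 ≤ dyadicConst α := by unfold dyadicConst; positivity
  set A := dyadicConst α * N * T ^ (-(1 / 2) : ℝ) with hA
  have hA0 : 0 ≤ A := by positivity
  set F : ℝ → ℂ := fun s => Complex.exp (Complex.I * (X * s - T * s ^ α : ℝ)) * g s with hF
  have hgc := h.continuous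
  have hFc : Continuous F := (exp_phase_continuous (by linarith) X T).mul hgc
  have hFn : ∀ s, ‖F s‖ = ‖g s‖ := fun s => by
    simp only [hF, norm_mul, Complex.norm_exp_I_mul_ofReal, one_mul]
  have hFi : IntegrableOn F (Ioi 0) :=
    h.integrableOn.norm.mono' hFc.aestronglyMeasurable (ae_of_all _ fun s => (hFn s).le)
  have hFii : ∀ u v, IntervalIntegrable F volume u v := fun u v => hFc.intervalIntegrable u v
  -- With `2^n ≤ T < 2^(n+1) = q`, the left endpoints `2^k`, `k ≤ n`, stay below `T`, while both
  -- tails, on `(0, 1/q]` and `(q, ∞)`, are at most `N q^(-1/2) ≤ N T^(-1/2)`.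
  obtain ⟨n, hn1, hn2⟩ := exists_nat_pow_near hT one_lt_two
  set q : ℝ := 2 ^ (n + 1) with hq
  have hq0 : 0 < q := by positivity
  have hqT : (√q)⁻¹ ≤ T ^ (-(1 / 2) : ℝ) := by
    rw [Real.rpow_neg hT0.le, ← Real.sqrt_eq_rpow]
    exact inv_anti₀ (Real.sqrt_pos.2 hT0) (Real.sqrt_le_sqrt hn2.le)
  have hlow : ‖∫ s in (0 : ℝ)..q⁻¹, F s‖ ≤ N * T ^ (-(1 / 2) : ℝ) := by
    rw [intervalIntegral.integral_of_le (by positivity)]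
    refine (norm_integral_le_integral_norm _).trans ?_
    simp only [hFn]
    refine (h.integral_norm_Ioc_le (by positivity)).trans ?_
    rw [Real.sqrt_inv]
    gcongr
  have hhigh : ‖∫ s in Ioi q, F s‖ ≤ N * T ^ (-(1 / 2) : ℝ) := by
    refine (norm_integral_le_integral_norm _).trans ?_
    simp only [hFn]
    refine (h.integral_norm_Ioi_le hq0).trans ?_
    gcongr
  have hgeom := sum_pow_le_inv_one_sub hr0 hr1 (n + 1)
  have hup : ‖∫ s in (1 : ℝ)..q, F s‖ ≤ A * (1 - r)⁻¹ := by
    have e := intervalIntegral.sum_integral_adjacent_intervals (f := F) (μ := volume)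
      (a := fun k => (2 : ℝ) ^ k) (n := n + 1) (fun k _ => hFii _ _)
    rw [pow_zero] at e
    rw [hq, ← e]
    refine (norm_sum_le _ _).trans ?_
    refine le_trans ?_ (mul_le_mul_of_nonneg_left hgeom hA0)
    rw [Finset.mul_sum]
    refine Finset.sum_le_sum fun k hk => ?_
    have hk' : k ≤ n := Nat.lt_succ_iff.1 (Finset.mem_range.1 hk)
    rw [pow_succ', hr, ← two_pow_rpow_neg]
    exact norm_integral_dyadic_le_of_one_le hα hα' h (one_le_pow₀ one_le_two)
      ((pow_le_pow_right₀ one_le_two hk').trans hn1)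
  have hdown : ‖∫ s in q⁻¹..(1 : ℝ), F s‖ ≤ A * (1 - r)⁻¹ := by
    have e := intervalIntegral.sum_integral_adjacent_intervals (f := F) (μ := volume)
      (a := fun k => ((2 : ℝ) ^ k)⁻¹) (n := n + 1) (fun k _ => hFii _ _)
    rw [pow_zero, inv_one] at e
    rw [intervalIntegral.integral_symm, norm_neg, hq, ← e]
    refine (norm_sum_le _ _).trans ?_
    refine le_trans ?_ (mul_le_mul_of_nonneg_left hgeom hA0)
    rw [Finset.mul_sum]
    refine Finset.sum_le_sum fun k hk => ?_
    -- The left endpoint is `2^(-(k+1))`, so the bound comes out with `r^(k+1)`, which is relaxed to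
    -- `r^k`.
    have e2 : ((2 : ℝ) ^ k)⁻¹ = 2 * ((2 : ℝ) ^ (k + 1))⁻¹ := by
      rw [pow_succ]; field_simp
    rw [intervalIntegral.integral_symm, norm_neg, e2]
    refine (norm_integral_dyadic_le_of_le_one hα hα' h hT (by positivity)
      (inv_le_one_of_one_le₀ (one_le_pow₀ one_le_two))).trans ?_
    rw [← hσ, Real.inv_rpow (by positivity), ← Real.rpow_neg (by positivity), two_pow_rpow_neg]
    refine mul_le_mul_of_nonneg_left ?_ hA0
    exact pow_le_pow_of_le_one hr0 hr1.le (Nat.le_succ k)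
  have hsplit : ∫ s in Ioi 0, F s = (∫ s in (0 : ℝ)..q⁻¹, F s) + (∫ s in q⁻¹..(1 : ℝ), F s) +
      (∫ s in (1 : ℝ)..q, F s) + ∫ s in Ioi q, F s := by
    rw [intervalIntegral.integral_add_adjacent_intervals (hFii _ _) (hFii _ _),
      intervalIntegral.integral_add_adjacent_intervals (hFii _ _) (hFii _ _),
      intervalIntegral.integral_interval_add_Ioi hFi (hFi.mono_set (Ioi_subset_Ioi hq0.le))]
  rw [hsplit]
  calc _ ≤ N * T ^ (-(1 / 2) : ℝ) + A * (1 - r)⁻¹ + A * (1 - r)⁻¹ + N * T ^ (-(1 / 2) : ℝ) :=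
        (norm_add_le _ _).trans (add_le_add ((norm_add_le _ _).trans
          (add_le_add ((norm_add_le _ _).trans (add_le_add hlow hdown)) hup)) hhigh)
    _ = _ := by rw [hA]; ring

end HalfLine

/-! ### Both signs of time, and small times -/

section SignedTime

variable {α : ℝ}

lemma HalfLineBound.conj {N : ℝ} {g g' : ℝ → ℂ} (h : HalfLineBound N g g') :
    HalfLineBound N (fun s => starRingEnd ℂ (g s)) (fun s => starRingEnd ℂ (g' s)) where
  hasDerivAt s := by
    have := (Complex.conjCLE.toContinuousLinearMap.hasFDerivAt (x := g s)).comp_hasDerivAt s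
      (h.hasDerivAt s)
    exact this
  continuous_deriv := Complex.continuous_conj.comp h.continuous_deriv
  tendsto := by
    have := (Complex.continuous_conj.tendsto 0).comp h.tendsto
    rwa [map_zero] at this
  integrableOn := (Complex.conjCLE.toContinuousLinearMap).integrable_comp h.integrableOn
  nonneg := h.nonneg
  integrableOn_sq := by simpa only [RCLike.norm_conj] using h.integrableOn_sq
  integral_sq_le := by simpa only [RCLike.norm_conj] using h.integral_sq_le
  integrableOn_mul_sq := by simpa only [RCLike.norm_conj] using h.integrableOn_mul_sq
  integral_mul_sq_le := by simpa only [RCLike.norm_conj] using h.integral_mul_sq_le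
  integrableOn_mul_deriv_sq := by simpa only [RCLike.norm_conj] using h.integrableOn_mul_deriv_sq
  integral_mul_deriv_sq_le := by simpa only [RCLike.norm_conj] using h.integral_mul_deriv_sq_le

lemma norm_integral_exp_neg_phase {S : Set ℝ} (f : ℝ → ℝ) (g : ℝ → ℂ) :
    ‖∫ s in S, Complex.exp (Complex.I * (-f s : ℝ)) * starRingEnd ℂ (g s)‖ =
      ‖∫ s in S, Complex.exp (Complex.I * f s) * g s‖ := by
  rw [← RCLike.norm_conj (∫ s in S, Complex.exp (Complex.I * f s) * g s), ← integral_conj]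
  congr 2 with s
  rw [map_mul, ← Complex.exp_conj]
  simp

lemma exists_norm_integral_Ioi_le (hα : 1 / 3 < α) (hα' : α < 1 / 2) :
    ∃ C : ℝ, 0 < C ∧ ∀ (N X T : ℝ) (g g' : ℝ → ℂ), HalfLineBound N g g' →
      ‖∫ s in Ioi 0, Complex.exp (Complex.I * (X * s + T * s ^ α : ℝ)) * g s‖ ≤
        C * N * (1 + |T|) ^ (-(1 / 2) : ℝ) := by
  set B := 2 + 2 * dyadicConst α * (1 - 2 ^ (-((3 * α - 1) / 4)))⁻¹ with hB
  have hr1 : (2 : ℝ) ^ (-((3 * α - 1) / 4)) < 1 :=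
    Real.rpow_lt_one_of_one_lt_of_neg one_lt_two (by linarith)
  have hK := stationaryConst_pos (by linarith : 0 < α) (by linarith : α < 1)
  have hK' : 0 ≤ dyadicConst α := by unfold dyadicConst; positivity
  -- For `|T| < 1` only `∫ |g| ≤ 2N` is used, so `B` must be at least `2`.
  have hB2 : 2 ≤ B := by
    have : 0 ≤ (1 - (2 : ℝ) ^ (-((3 * α - 1) / 4)))⁻¹ := inv_nonneg.2 (by linarith)
    have : 0 ≤ 2 * dyadicConst α * (1 - 2 ^ (-((3 * α - 1) / 4)))⁻¹ := by positivity
    linarith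
  refine ⟨B * 2 ^ (1 / 2 : ℝ), by positivity, fun N X T g g' h => ?_⟩
  have hN := h.nonneg
  suffices H : ‖∫ s in Ioi 0, Complex.exp (Complex.I * (X * s + T * s ^ α : ℝ)) * g s‖ ≤
      B * (N * (max 1 |T|) ^ (-(1 / 2) : ℝ)) by
    refine H.trans ?_
    -- Since `max(1, |T|) ≥ (1 + |T|)/2`, passing to `1 + |T|` costs the factor `2^(1/2)`.
    have h1 : (max 1 |T|) ^ (-(1 / 2) : ℝ) ≤ ((1 + |T|) / 2) ^ (-(1 / 2) : ℝ) := by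
      refine Real.rpow_le_rpow_of_nonpos (by positivity) ?_ (by norm_num)
      have := le_max_left 1 |T|
      have := le_max_right 1 |T|
      linarith
    rw [Real.div_rpow (by positivity) zero_le_two, Real.rpow_neg zero_le_two, div_inv_eq_mul] at h1
    calc B * (N * (max 1 |T|) ^ (-(1 / 2) : ℝ))
        ≤ B * (N * ((1 + |T|) ^ (-(1 / 2) : ℝ) * 2 ^ (1 / 2 : ℝ))) := by gcongr
      _ = _ := by ring
  rcases lt_or_ge |T| 1 with hT | hT
  · rw [max_eq_left hT.le, Real.one_rpow, mul_one]
    refine (norm_integral_le_integral_norm _).trans ?_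
    simp only [norm_mul, Complex.norm_exp_I_mul_ofReal, one_mul]
    refine h.integral_norm_le.trans ?_
    gcongr
  · rw [max_eq_right hT]
    rcases le_total T 0 with hT0 | hT0
    · rw [abs_of_nonpos hT0] at hT ⊢
      have := norm_integral_Ioi_phase_le (X := X) hα hα' h hT
      simpa using this
    · rw [abs_of_nonneg hT0] at hT ⊢
      -- For `T > 0` the phase is concave; conjugating the integral negates it and restores
      -- convexity.
      have := norm_integral_Ioi_phase_le (X := -X) hα hα' h.conj hT
      rw [← norm_integral_exp_neg_phase]
      refine le_trans (le_of_eq ?_) this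
      congr 2 with s
      congr 4
      ring

end SignedTime

/-! ### From the half-line to the whole line by reflection -/

section FullLine

lemma HalfLineBound.of_integrable {N : ℝ} {g g' : ℝ → ℂ} (hg : ∀ s, HasDerivAt g (g' s) s)
    (hc : Continuous g') (ht : Tendsto g atTop (𝓝 0)) (hi : Integrable g) (hN : 0 ≤ N)
    (hi0 : Integrable fun s => ‖g s‖ ^ 2) (h0 : ∫ s, ‖g s‖ ^ 2 ≤ N ^ 2)
    (hi1 : Integrable fun s => (|s| * ‖g s‖) ^ 2) (h1 : ∫ s, (|s| * ‖g s‖) ^ 2 ≤ N ^ 2)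
    (hi2 : Integrable fun s => (|s| * ‖g' s‖) ^ 2) (h2 : ∫ s, (|s| * ‖g' s‖) ^ 2 ≤ N ^ 2) :
    HalfLineBound N g g' where
  hasDerivAt := hg
  continuous_deriv := hc
  tendsto := ht
  integrableOn := hi.integrableOn
  nonneg := hN
  integrableOn_sq := hi0.integrableOn
  integral_sq_le := (setIntegral_le_integral hi0 (ae_of_all _ fun _ => sq_nonneg _)).trans h0
  integrableOn_mul_sq := hi1.integrableOn
  integral_mul_sq_le := (setIntegral_le_integral hi1 (ae_of_all _ fun _ => sq_nonneg _)).trans h1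
  integrableOn_mul_deriv_sq := hi2.integrableOn
  integral_mul_deriv_sq_le :=
    (setIntegral_le_integral hi2 (ae_of_all _ fun _ => sq_nonneg _)).trans h2

lemma exists_norm_integral_schwartz_le {α : ℝ} (hα : 1 / 3 < α) (hα' : α < 1 / 2) :
    ∃ C : ℝ, 0 < C ∧ ∀ (N X T : ℝ) (G : 𝓢(ℝ, ℂ)), 0 ≤ N →
      ∫ s, ‖G s‖ ^ 2 ≤ N ^ 2 →
      Integrable (fun s => (|s| * ‖G s‖) ^ 2) → ∫ s, (|s| * ‖G s‖) ^ 2 ≤ N ^ 2 →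
      Integrable (fun s => (|s| * ‖deriv G s‖) ^ 2) → ∫ s, (|s| * ‖deriv G s‖) ^ 2 ≤ N ^ 2 →
      ‖∫ s, Complex.exp (Complex.I * (X * s + T * |s| ^ α : ℝ)) * G s‖ ≤
        C * N * (1 + |T|) ^ (-(1 / 2) : ℝ) := by
  obtain ⟨C, hC, H⟩ := exists_norm_integral_Ioi_le hα hα'
  refine ⟨2 * C, by positivity, fun N X T G hN h0 hi1 h1 hi2 h2 => ?_⟩
  have hi0 : Integrable fun s => ‖G s‖ ^ 2 :=
    (memLp_two_iff_integrable_sq_norm (G.memLp 2).1).1 (G.memLp 2)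
  have hdc : Continuous (deriv G) := (derivCLM ℝ ℂ G).continuous
  have hp : HalfLineBound N G (deriv G) := .of_integrable G.hasDerivAt hdc
    (G.tendsto_cocompact.mono_left atTop_le_cocompact) G.integrable hN hi0 h0 hi1 h1 hi2 h2
  have hm : HalfLineBound N (fun s => G (-s)) (fun s => -deriv G (-s)) := .of_integrable
    (fun s => ((G.hasDerivAt (-s)).scomp s (hasDerivAt_neg s)).congr_deriv (by simp))
    (hdc.comp continuous_neg).neg
    ((G.tendsto_cocompact.mono_left atBot_le_cocompact).comp tendsto_neg_atTop_atBot)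
    G.integrable.comp_neg hN hi0.comp_neg
    (by rwa [integral_neg_eq_self (fun s => ‖G s‖ ^ 2)])
    (by simpa only [abs_neg] using hi1.comp_neg)
    (by
      rw [← integral_neg_eq_self] at h1
      simpa only [abs_neg] using h1)
    (by simpa only [abs_neg, norm_neg] using hi2.comp_neg)
    (by
      rw [← integral_neg_eq_self] at h2
      simpa only [abs_neg, norm_neg] using h2)
  set F : ℝ → ℂ := fun s => Complex.exp (Complex.I * (X * s + T * |s| ^ α : ℝ)) * G s with hF
  have hFc : Continuous F := by
    have : Continuous fun s : ℝ => |s| ^ α :=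
      (Real.continuous_rpow_const (by linarith)).comp continuous_abs
    have := G.continuous
    fun_prop
  have hFi : Integrable F := G.integrable.norm.mono' hFc.aestronglyMeasurable
    (ae_of_all _ fun s => by simp only [hF, norm_mul, Complex.norm_exp_I_mul_ofReal, one_mul, le_refl])
  have hsplit : ∫ s, F s = (∫ s in Ioi 0, F (-s)) + ∫ s in Ioi 0, F s := by
    rw [integral_comp_neg_Ioi, neg_zero,
      intervalIntegral.integral_Iic_add_Ioi hFi.integrableOn hFi.integrableOn]
  have e1 : ∫ s in Ioi 0, F s =
      ∫ s in Ioi 0, Complex.exp (Complex.I * (X * s + T * s ^ α : ℝ)) * G s :=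
    setIntegral_congr_fun measurableSet_Ioi fun s hs => by
      simp only [hF, abs_of_pos (mem_Ioi.1 hs)]
  have e2 : ∫ s in Ioi 0, F (-s) =
      ∫ s in Ioi 0, Complex.exp (Complex.I * (-X * s + T * s ^ α : ℝ)) * G (-s) :=
    setIntegral_congr_fun measurableSet_Ioi fun s hs => by
      simp only [hF, abs_neg, abs_of_pos (mem_Ioi.1 hs), mul_neg, neg_mul]
  rw [hsplit, e1, e2]
  refine (norm_add_le _ _).trans ?_
  have b1 := H N X T _ _ hp
  have b2 := H N (-X) T _ _ hm
  linarith

end FullLine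

/-! ### Fourier identities and the change to Mathlib's normalisation -/

section Fourier

lemma l2Norm_nonneg (f : ℝ → ℂ) : 0 ≤ l2Norm f := ENNReal.toReal_nonneg

lemma SchwartzMap.l2Norm_sq (f : 𝓢(ℝ, ℂ)) : l2Norm f ^ 2 = ∫ s, ‖f s‖ ^ 2 := by
  have h0 : 0 ≤ ∫ s, ‖f s‖ ^ 2 := integral_nonneg fun _ => by positivity
  rw [l2Norm, (f.memLp 2 volume).eLpNorm_eq_integral_rpow_norm two_ne_zero ENNReal.ofNat_ne_top]
  simp only [ENNReal.toReal_ofNat, Real.rpow_two]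
  rw [ENNReal.toReal_ofReal (by positivity), ← Real.rpow_natCast, ← Real.rpow_mul h0]
  norm_num

lemma SchwartzMap.integrable_norm_sq (f : 𝓢(ℝ, ℂ)) : Integrable fun s => ‖f s‖ ^ 2 :=
  (memLp_two_iff_integrable_sq_norm (f.memLp 2).1).1 (f.memLp 2)

/-- The Schwartz function `x ↦ x f(x)`. -/
noncomputable def SchwartzMap.mulX (f : 𝓢(ℝ, ℂ)) : 𝓢(ℝ, ℂ) :=
  smulLeftCLM ℂ (fun x : ℝ => (x : ℂ)) f

lemma SchwartzMap.mulX_apply (f : 𝓢(ℝ, ℂ)) (x : ℝ) : f.mulX x = x * f x := by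
  rw [mulX, smulLeftCLM_apply_apply (by fun_prop), smul_eq_mul]

lemma SchwartzMap.coe_derivCLM (f : 𝓢(ℝ, ℂ)) : ⇑(derivCLM ℂ ℂ f) = deriv f :=
  funext fun x => derivCLM_apply ℂ f x

lemma SchwartzMap.fourier_derivCLM_apply (f : 𝓢(ℝ, ℂ)) (w : ℝ) :
    𝓕 (derivCLM ℂ ℂ f) w = 2 * Real.pi * Complex.I * w * 𝓕 f w := by
  rw [fourier_coe, fourier_coe, coe_derivCLM,
    Real.fourier_deriv f.integrable f.differentiable
      (by rw [← coe_derivCLM]; exact (derivCLM ℂ ℂ f).integrable)]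
  rfl

lemma SchwartzMap.deriv_fourier_apply (f : 𝓢(ℝ, ℂ)) (w : ℝ) :
    deriv (𝓕 f : 𝓢(ℝ, ℂ)) w = -2 * Real.pi * Complex.I * 𝓕 f.mulX w := by
  rw [fourier_coe, fourier_coe]
  refine (Real.hasDerivAt_fourier f.integrable ?_ w).deriv.trans ?_
  · refine f.mulX.integrable.congr (ae_of_all _ fun x => ?_)
    simp [mulX_apply]
  · have e : (fun x : ℝ => (-2 * Real.pi * Complex.I * x) • f x) =
        (-2 * Real.pi * Complex.I : ℂ) • (f.mulX : ℝ → ℂ) := by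
      ext x; simp [mulX_apply]; ring
    rw [e]
    simp only [Real.fourier_eq, Pi.smul_apply, smul_eq_mul]
    rw [← integral_const_mul]
    refine integral_congr_ae (ae_of_all _ fun x => ?_)
    simp only [Circle.smul_def, smul_eq_mul]
    ring

/-- The Fourier transform intertwines `x ∂ₓ` with `-∂_ξ ξ`. -/
lemma SchwartzMap.mul_deriv_fourier (f : 𝓢(ℝ, ℂ)) (w : ℝ) :
    w * deriv (𝓕 f : 𝓢(ℝ, ℂ)) w = -𝓕 (derivCLM ℂ ℂ f).mulX w - 𝓕 f w := by
  have hpi : (2 * Real.pi * Complex.I : ℂ) ≠ 0 := by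
    simp [Real.pi_ne_zero, Complex.I_ne_zero]
  have h1 := deriv_fourier_apply (derivCLM ℂ ℂ f) w
  -- The derivative of `𝓕 f'` is computed a second time, from the product `2πi w 𝓕 f(w)`; comparison
  -- with `h1` gives the identity.
  have h2 : HasDerivAt (𝓕 (derivCLM ℂ ℂ f) : 𝓢(ℝ, ℂ)) (2 * Real.pi * Complex.I *
      (𝓕 f w + w * deriv (𝓕 f : 𝓢(ℝ, ℂ)) w)) w := by
    have h3 := (((hasDerivAt_id' w).ofReal_comp).mul ((𝓕 f).hasDerivAt w)).const_mul
      (2 * Real.pi * Complex.I)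
    refine (h3.congr_deriv (by simp)).congr_of_eventuallyEq (Eventually.of_forall fun v => ?_)
    simp only [fourier_derivCLM_apply, Pi.mul_apply]
    ring
  rw [h2.deriv] at h1
  have h4 : (2 * Real.pi * Complex.I) * (𝓕 f w + w * deriv (𝓕 f : 𝓢(ℝ, ℂ)) w) =
      (2 * Real.pi * Complex.I) * (-𝓕 (derivCLM ℂ ℂ f).mulX w) := by rw [h1]; ring
  linear_combination mul_left_cancel₀ hpi h4

lemma fourierHat_eq (φ : 𝓢(ℝ, ℂ)) (ξ : ℝ) : fourierHat φ ξ = 𝓕 φ (ξ / (2 * Real.pi)) := by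
  rw [fourier_coe, Real.fourier_real_eq_integral_exp_smul, fourierHat]
  refine integral_congr_ae (ae_of_all _ fun x => ?_)
  simp only [smul_eq_mul]
  congr 2
  rw [show -2 * Real.pi * x * (ξ / (2 * Real.pi)) = -(x * ξ) by
    have := Real.pi_ne_zero; field_simp]
  push_cast; ring

/-- The substitution `ξ = 2π s` absorbs the prefactor `1/(2π)` and, by homogeneity of the symbol,
rescales time by `(2π)^α`. -/
lemma expMultiplier_powerSymbol_eq (α t : ℝ) (φ : 𝓢(ℝ, ℂ)) (x : ℝ) :
    expMultiplier (powerSymbol α) t φ x = ∫ s : ℝ, Complex.exp (Complex.I *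
      (2 * Real.pi * x * s + t * (2 * Real.pi) ^ α * |s| ^ α : ℝ)) * 𝓕 φ s := by
  have h2pi : 0 < 2 * Real.pi := Real.two_pi_pos
  have h := Measure.integral_comp_div (fun s : ℝ => Complex.exp (Complex.I *
      (2 * Real.pi * x * s + t * (2 * Real.pi) ^ α * |s| ^ α : ℝ)) * 𝓕 φ s) (2 * Real.pi)
  rw [abs_of_pos h2pi, Complex.real_smul] at h
  rw [expMultiplier, ← mul_right_inj' (show ((2 * Real.pi : ℝ) : ℂ) ≠ 0 by
    exact_mod_cast h2pi.ne'), ← h, ← mul_assoc, ← Complex.ofReal_mul, mul_inv_cancel₀ h2pi.ne',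
    Complex.ofReal_one, one_mul]
  refine integral_congr_ae (ae_of_all _ fun ξ => ?_)
  simp only [fourierHat_eq, ← mul_assoc, ← Complex.exp_add, powerSymbol]
  congr 2
  rw [← mul_add, ← Complex.ofReal_add]
  congr 2
  rw [abs_div, abs_of_pos h2pi, Real.div_rpow (abs_nonneg _) h2pi.le]
  have : (2 * Real.pi) ^ α ≠ 0 := by positivity
  have := Real.pi_ne_zero
  field_simp

end Fourier

/-! ### Assembly of the dispersive estimate -/

theorem mainTheorem2 (α : ℝ) (hα : 1 / 3 < α) (hα' : α < 1 / 2) :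
    ∃ C : ℝ, 0 < C ∧ ∀ (t : ℝ) (φ : 𝓢(ℝ, ℂ)),
      eLpNorm (expMultiplier (powerSymbol α) t φ) ∞ volume ≤
        ENNReal.ofReal (C * (1 + |t|) ^ (-(1 / 2) : ℝ) *
          (h1Norm φ + l2Norm (fun x : ℝ => (x : ℂ) * deriv φ x))) := by
  obtain ⟨C, hC, H⟩ := exists_norm_integral_schwartz_le hα hα'
  refine ⟨C * 2, by positivity, fun t φ => ?_⟩
  have hpi : 3 < Real.pi := Real.pi_gt_three
  set ψ : 𝓢(ℝ, ℂ) := (derivCLM ℂ ℂ φ).mulX with hψ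
  have hψe : (fun x : ℝ => (x : ℂ) * deriv φ x) = ψ := by
    ext x; rw [hψ, mulX_apply, coe_derivCLM]
  rw [hψe]
  set N := h1Norm φ + l2Norm ψ with hN
  have hh : h1Norm φ ^ 2 = l2Norm φ ^ 2 + l2Norm (deriv φ) ^ 2 :=
    Real.sq_sqrt (by positivity)
  have hh0 : 0 ≤ h1Norm φ := Real.sqrt_nonneg _
  have hψ0 := l2Norm_nonneg ψ
  have hN0 : 0 ≤ N := by positivity
  have hN2 : l2Norm φ ^ 2 + l2Norm (deriv φ) ^ 2 + l2Norm ψ ^ 2 ≤ N ^ 2 := by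
    rw [← hh, hN]; nlinarith
  have hsq1 := sq_nonneg (l2Norm φ)
  have hsq2 := sq_nonneg (l2Norm (deriv φ))
  have hsq3 := sq_nonneg (l2Norm ψ)
  have i0 : ∫ s, ‖𝓕 φ s‖ ^ 2 = l2Norm φ ^ 2 := by
    rw [SchwartzMap.integral_norm_sq_fourier, l2Norm_sq]
  have i1 : ∫ s, ‖𝓕 (derivCLM ℂ ℂ φ) s‖ ^ 2 = l2Norm (deriv φ) ^ 2 := by
    rw [SchwartzMap.integral_norm_sq_fourier, ← l2Norm_sq, coe_derivCLM]
  have i2 : ∫ s, ‖𝓕 ψ s‖ ^ 2 = l2Norm ψ ^ 2 := by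
    rw [SchwartzMap.integral_norm_sq_fourier, l2Norm_sq]
  have g0 := (𝓕 φ).integrable_norm_sq
  have g1 := (𝓕 (derivCLM ℂ ℂ φ)).integrable_norm_sq
  have g2 := (𝓕 ψ).integrable_norm_sq
  have p1 : ∀ s, (|s| * ‖𝓕 φ s‖) ^ 2 ≤ ‖𝓕 (derivCLM ℂ ℂ φ) s‖ ^ 2 := fun s => by
    have e : ‖𝓕 (derivCLM ℂ ℂ φ) s‖ = 2 * Real.pi * (|s| * ‖𝓕 φ s‖) := by
      rw [fourier_derivCLM_apply]
      simp [abs_of_pos Real.pi_pos]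
      ring
    rw [e]
    refine pow_le_pow_left₀ (by positivity) (le_mul_of_one_le_left (by positivity) ?_) 2
    linarith
  have p2 : ∀ s, (|s| * ‖deriv (𝓕 φ : 𝓢(ℝ, ℂ)) s‖) ^ 2 ≤ 2 * ‖𝓕 ψ s‖ ^ 2 + 2 * ‖𝓕 φ s‖ ^ 2 := fun s => by
    have e : |s| * ‖deriv (𝓕 φ : 𝓢(ℝ, ℂ)) s‖ ≤ ‖𝓕 ψ s‖ + ‖𝓕 φ s‖ := by
      rw [← Real.norm_eq_abs, ← Complex.norm_real, ← norm_mul, mul_deriv_fourier]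
      exact (norm_sub_le _ _).trans (by rw [norm_neg])
    refine (pow_le_pow_left₀ (by positivity) e 2).trans ?_
    nlinarith [sq_nonneg (‖𝓕 ψ s‖ - ‖𝓕 φ s‖)]
  have hc0 : Continuous (𝓕 φ : 𝓢(ℝ, ℂ)) := (𝓕 φ).continuous
  have hc1 : Continuous (deriv (𝓕 φ : 𝓢(ℝ, ℂ))) := (derivCLM ℝ ℂ (𝓕 φ)).continuous
  have q1 : Integrable fun s => (|s| * ‖𝓕 φ s‖) ^ 2 :=
    g1.mono' (by fun_prop) (ae_of_all _ fun s => by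
      rw [Real.norm_of_nonneg (by positivity)]; exact p1 s)
  have g3 := (g2.const_mul 2).add (g0.const_mul 2)
  have q2 : Integrable fun s => (|s| * ‖deriv (𝓕 φ : 𝓢(ℝ, ℂ)) s‖) ^ 2 :=
    g3.mono' (by fun_prop) (ae_of_all _ fun s => by
      rw [Real.norm_of_nonneg (by positivity)]; exact p2 s)
  -- The size `2N` is dictated by `s G'`: its square integral is at most `2‖xφ'‖² + 2‖φ‖² ≤ 2N²`,
  -- which exceeds `N²` but not `(2N)²`.
  have b1 : ∫ s, (|s| * ‖𝓕 φ s‖) ^ 2 ≤ (2 * N) ^ 2 := by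
    refine (integral_mono q1 g1 p1).trans ?_
    rw [i1]; nlinarith
  have b2 : ∫ s, (|s| * ‖deriv (𝓕 φ : 𝓢(ℝ, ℂ)) s‖) ^ 2 ≤ (2 * N) ^ 2 := by
    refine (integral_mono q2 g3 p2).trans ?_
    simp only [Pi.add_apply]
    rw [integral_add (g2.const_mul 2) (g0.const_mul 2), integral_const_mul, integral_const_mul,
      i0, i2]
    nlinarith
  have b0 : ∫ s, ‖𝓕 φ s‖ ^ 2 ≤ (2 * N) ^ 2 := by rw [i0]; nlinarith
  rw [eLpNorm_exponent_top]
  refine eLpNormEssSup_le_of_ae_bound (ae_of_all _ fun x => ?_)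
  rw [expMultiplier_powerSymbol_eq]
  refine (H (2 * N) (2 * Real.pi * x) (t * (2 * Real.pi) ^ α) (𝓕 φ) (by positivity) b0 q1 b1
    q2 b2).trans ?_
  -- The rescaled time is no smaller than `|t|`, since `(2π)^α ≥ 1`.
  have ht : (1 + |t * (2 * Real.pi) ^ α|) ^ (-(1 / 2) : ℝ) ≤ (1 + |t|) ^ (-(1 / 2) : ℝ) := by
    refine Real.rpow_le_rpow_of_nonpos (by positivity) ?_ (by norm_num)
    have h1 : 1 ≤ (2 * Real.pi) ^ α := Real.one_le_rpow (by linarith) (by linarith)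
    rw [abs_mul, abs_of_nonneg (by positivity : 0 ≤ (2 * Real.pi) ^ α)]
    have := le_mul_of_one_le_right (abs_nonneg t) h1
    linarith
  calc C * (2 * N) * (1 + |t * (2 * Real.pi) ^ α|) ^ (-(1 / 2) : ℝ)
      ≤ C * (2 * N) * (1 + |t|) ^ (-(1 / 2) : ℝ) := by gcongr
    _ = _ := by ring
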